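/- **Setting.** Let $\mathcal X=[-1,1]^D$, let $f:\mathbb R^D\to\mathbb R$ be $L$-Lipschitz in the Euclidean norm, and put $f^*=\min_{x\in\mathcal X}f(x)$, $G=\{x\in\mathcal X: f(x)=f^*\}$ and $G_\epsilon=\{x\in\mathcal X: f(x)\le f^*+\epsilon\}$. Assume that $f$ has effective dimension $d_e$, i.e. $d_e$ is the least dimension of a linear subspace $\mathcal T$ such that $f(u+v)=f(u)$ for all $u\in\mathcal T$, $v\in\mathcal T^\perp$; fix such a $\mathcal T$ of dimension $d_e$, and assume $d_e<D$ and $d_e\le d$. Let the orthonormal columns of $U\in\mathbb R^{D\times d_e}$ and $V\in\mathbb R^{D\times(D-d_e)}$ span $\mathcal T$ and $\mathcal T^\perp$. For $x^*\in G$ let $x^*_\top=UU^Tx^*$ and $G^*=\mathcal X\cap(x^*_\top+\mathcal T^\perp)$; call $G^*$ non-degenerate if $\{g\in\mathbb R^{D-d_e}: x^*_\top+Vg\in G^*\}$ has positive volume. Assume that $G^*$ is non-degenerate for some $x^*\in G$. Let $0<\lambda<\epsilon$. For a $D\times d$ matrix $A$ and $p\in\mathcal X$, the reduced problem is to minimize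 $f(Ay+p)$ over $y\in\mathbb R^d$ with $Ay+p\in\mathcal X$. It is $\delta$-successful if some such $y$ satisfies $f(Ay+p)\le f^*+\delta$. A Gaussian matrix has independent $\mathcal N(0,1)$ entries. **The algorithm (X-REGO).** A run consists of random variables $p^0,p^1,\dots$ with values in $\mathcal X$ almost surely and, for $k\ge1$, random $D\times d$ matrices $A^k$ and vectors $y^k\in\mathbb R^d$ on a probability space, such that $A^k$ is Gaussian and independent of $\mathcal F^{k-1}$, where $\mathcal F^k=\sigma(A^1,\dots,A^k,y^1,\dots,y^k,p^0,\dots,p^k)$, and such that $y^k$ is almost surely feasible for the reduced problem with $A=A^k$, $p=p^{k-1}$; the $y^k$ and $p^k$ are otherwise arbitrary. Put $\mathcal F^{k-1/2}=\sigma(A^1,\dots,A^k,y^1,\dots,y^{k-1},p^0,\dots,p^{k-1})$ and $x^k=A^ky^k+p^{k-1}$, let $f^k_{\min}$ be the optimal value of the $k$-th reduced problem, let $S^k$ be the indicator of the event $f(x^k)\le f^k_{\min}+\lambda$, and let $x^k_{opt}$ be a point with the smallest value of $f$ among $x^1,\dots,x^k$ (ties broken arbitrarily). **Theorem (Global convergence).**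 (i) There is $\tau\in(0,1]$ such that for every $p\in\mathcal X$ the reduced problem with a Gaussian matrix is $(\epsilon-\lambda)$-successful with probability at least $\tau$. (ii) Let $\tau>0$ be any constant with the property in (i), let $\rho\in(0,1]$, and consider any run of X-REGO such that $\mathbb E[S^k\mid\mathcal F^{k-1/2}]\ge\rho$ almost surely for all $k\ge1$. Then for all $k\ge1$ $$\mathbb P[x^k_{opt}\in G_\epsilon]=\mathbb P[f(x^k_{opt})\le f^*+\epsilon]\ \ge\ 1-(1-\tau\rho)^k ,$$ where the right-hand side tends to $1$ as $k\to\infty$; hence $$\lim_{k\to\infty}\mathbb P[x^k_{opt}\in G_\epsilon]=\lim_{k\to\infty}\mathbb P[f(x^k_{opt})\le f^*+\epsilon]=1 .$$ Furthermore, for every $\xi\in(0,1)$, $$\mathbb P[x^k_{opt}\in G_\epsilon]=\mathbb P[f(x^k_{opt})\le f^*+\epsilon]\ge\xi\qquad\text{for all } k\ge\left\lceil\frac{|\log(1-\xi)|}{\tau\rho}\right\rceil .$$ -/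

import Mathlib

open MeasureTheory ProbabilityTheory Filter Topology
open scoped NNReal Matrix

noncomputable section

namespace XRego

/-- Action of a real matrix on Euclidean vectors: the product `A y`. -/
def act {m n : ℕ} (A : Matrix (Fin m) (Fin n) ℝ) (y : EuclideanSpace ℝ (Fin n)) :
    EuclideanSpace ℝ (Fin m) :=
  WithLp.toLp 2 (A *ᵥ y.ofLp)

/-! ### The optimization problem -/

/-- The box `𝒳 = [-1,1]^D`. -/
def box (D : ℕ) : Set (EuclideanSpace ℝ (Fin D)) :=
  {x | ∀ i, -1 ≤ x i ∧ x i ≤ 1}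

/-- `f* = min_{x ∈ 𝒳} f x` (attained whenever `f` is continuous). -/
def fStar {D : ℕ} (f : EuclideanSpace ℝ (Fin D) → ℝ) : ℝ :=
  sInf (f '' box D)

/-- The set `G` of feasible global minimizers. -/
def minimizers {D : ℕ} (f : EuclideanSpace ℝ (Fin D) → ℝ) : Set (EuclideanSpace ℝ (Fin D)) :=
  {x | x ∈ box D ∧ f x = fStar f}

/-- The set `G_ε` of feasible `ε`-minimizers. -/
def epsMinimizers {D : ℕ} (f : EuclideanSpace ℝ (Fin D) → ℝ) (ε : ℝ) :
    Set (EuclideanSpace ℝ (Fin D)) :=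
  {x | x ∈ box D ∧ f x ≤ fStar f + ε}

/-! ### Low effective dimensionality -/

/-- `f (x_⊤ + x_⊥) = f x_⊤` for all `x_⊤ ∈ T` and `x_⊥ ∈ Tᗮ`. -/
def VariesOnlyAlong {D : ℕ} (f : EuclideanSpace ℝ (Fin D) → ℝ)
    (T : Submodule ℝ (EuclideanSpace ℝ (Fin D))) : Prop :=
  ∀ u ∈ T, ∀ v ∈ Tᗮ, f (u + v) = f u

/-- `f` has effective dimension `de`: the least dimension of a subspace along which alone
`f` varies. -/
def HasEffectiveDim {D : ℕ} (f : EuclideanSpace ℝ (Fin D) → ℝ) (de : ℕ) : Prop :=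
  IsLeast {n : ℕ | ∃ T : Submodule ℝ (EuclideanSpace ℝ (Fin D)),
    Module.finrank ℝ T = n ∧ VariesOnlyAlong f T} de

/-- The columns of `W` are orthonormal and span the subspace `S`. -/
def IsOrthonormalFrame {D m : ℕ} (W : Matrix (Fin D) (Fin m) ℝ)
    (S : Submodule ℝ (EuclideanSpace ℝ (Fin D))) : Prop :=
  Wᵀ * W = 1 ∧ ∀ x, x ∈ S ↔ ∃ g, act W g = x

/-- `f` is continuous with effective dimension `de`, where `de < D` and `de ≤ d`, effective
subspace `T` and constant subspace `Tᗮ`, spanned by the orthonormal columns of `U` and `V`. -/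
structure LowEffectiveDim {D : ℕ} (f : EuclideanSpace ℝ (Fin D) → ℝ) (d de : ℕ)
    (T : Submodule ℝ (EuclideanSpace ℝ (Fin D)))
    (U : Matrix (Fin D) (Fin de) ℝ) (V : Matrix (Fin D) (Fin (D - de)) ℝ) : Prop where
  continuous : Continuous f
  effectiveDim : HasEffectiveDim f de
  lt_ambient : de < D
  le_embedding : de ≤ d
  finrank_eq : Module.finrank ℝ T = de
  varies : VariesOnlyAlong f T
  frame_top : IsOrthonormalFrame U T
  frame_perp : IsOrthonormalFrame V Tᗮ

/-- The component `G* = {x ∈ 𝒳 : x ∈ x*_⊤ + Tᗮ}` determined by a global minimizer `x*`, where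
`x*_⊤ = U Uᵀ x*`. -/
def component {D de : ℕ} (T : Submodule ℝ (EuclideanSpace ℝ (Fin D)))
    (U : Matrix (Fin D) (Fin de) ℝ) (xs : EuclideanSpace ℝ (Fin D)) :
    Set (EuclideanSpace ℝ (Fin D)) :=
  {x | x ∈ box D ∧ x - act (U * Uᵀ) xs ∈ Tᗮ}

/-- The set `{g ∈ ℝ^(D - de) : x*_⊤ + V g ∈ G*}` of admissible coordinates of `G*`. -/
def admissible {D de : ℕ} (T : Submodule ℝ (EuclideanSpace ℝ (Fin D)))
    (U : Matrix (Fin D) (Fin de) ℝ) (V : Matrix (Fin D) (Fin (D - de)) ℝ)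
    (xs : EuclideanSpace ℝ (Fin D)) : Set (EuclideanSpace ℝ (Fin (D - de))) :=
  {g | act (U * Uᵀ) xs + act V g ∈ component T U xs}

/-- Some component `G*` is non-degenerate: its set of admissible coordinates has positive
`(D - de)`-dimensional volume. -/
def ExistsNondegenerate {D de : ℕ} (f : EuclideanSpace ℝ (Fin D) → ℝ)
    (T : Submodule ℝ (EuclideanSpace ℝ (Fin D)))
    (U : Matrix (Fin D) (Fin de) ℝ) (V : Matrix (Fin D) (Fin (D - de)) ℝ) : Prop :=
  ∃ xs ∈ minimizers f, 0 < volume (admissible T U V xs)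

/-! ### Gaussian matrices and the reduced problem -/

/-- The Borel (product) σ-algebra on real matrices. -/
instance instMeasurableSpaceMatrix (m n : ℕ) : MeasurableSpace (Matrix (Fin m) (Fin n) ℝ) :=
  inferInstanceAs (MeasurableSpace (Fin m → Fin n → ℝ))

/-- The law of a `D × d` Gaussian matrix: independent standard normal entries. -/
def gaussianMatrix (D d : ℕ) : Measure (Matrix (Fin D) (Fin d) ℝ) :=
  (Measure.pi (fun _ : Fin D => Measure.pi (fun _ : Fin d => gaussianReal 0 1)) :
    Measure (Fin D → Fin d → ℝ))

/-- The feasible set `{y ∈ ℝ^d : A y + p ∈ 𝒳}` of the reduced problem. -/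
def feasible {D d : ℕ} (A : Matrix (Fin D) (Fin d) ℝ) (p : EuclideanSpace ℝ (Fin D)) :
    Set (EuclideanSpace ℝ (Fin d)) :=
  {y | act A y + p ∈ box D}

/-- The optimal value of the reduced problem: the minimum of `f (A y + p)` over feasible `y`. -/
def fMin {D d : ℕ} (f : EuclideanSpace ℝ (Fin D) → ℝ) (A : Matrix (Fin D) (Fin d) ℝ)
    (p : EuclideanSpace ℝ (Fin D)) : ℝ :=
  sInf ((fun y => f (act A y + p)) '' feasible A p)

/-- The reduced problem is `δ`-successful: some feasible `y` has `f (A y + p) ≤ f* + δ`. -/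
def EpsSuccessful {D d : ℕ} (f : EuclideanSpace ℝ (Fin D) → ℝ) (δ : ℝ)
    (A : Matrix (Fin D) (Fin d) ℝ) (p : EuclideanSpace ℝ (Fin D)) : Prop :=
  ∃ y ∈ feasible A p, f (act A y + p) ≤ fStar f + δ

/-- `τ` is a lower bound, uniform in `p ∈ 𝒳`, on the probability that the reduced problem with a
`D × d` Gaussian matrix is `δ`-successful. -/
def IsSuccessBound {D : ℕ} (f : EuclideanSpace ℝ (Fin D) → ℝ) (d : ℕ) (δ τ : ℝ) : Prop :=
  ∀ p ∈ box D, τ ≤ (gaussianMatrix D d).real {A | EpsSuccessful f δ A p}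

/-! ### The X-REGO algorithm as a stochastic process

The matrices `A k` and the reduced solutions `y k` are used for `k ≥ 1`, the points `p k` for
`k ≥ 0`; the values `A 0` and `y 0` play no role. -/

section XRegoRun

variable {D d : ℕ} {Ω : Type*} [MeasurableSpace Ω]

/-- The candidate `x^k = A^k y^k + p^(k-1)`, for `k ≥ 1`. -/
def iterate (A : ℕ → Ω → Matrix (Fin D) (Fin d) ℝ) (y : ℕ → Ω → EuclideanSpace ℝ (Fin d))
    (p : ℕ → Ω → EuclideanSpace ℝ (Fin D)) (k : ℕ) (ω : Ω) : EuclideanSpace ℝ (Fin D) :=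
  act (A k ω) (y k ω) + p (k - 1) ω

/-- `σ(A^1, …, A^a, y^1, …, y^b, p^0, …, p^c)`. -/
def sigmaGen (A : ℕ → Ω → Matrix (Fin D) (Fin d) ℝ) (y : ℕ → Ω → EuclideanSpace ℝ (Fin d))
    (p : ℕ → Ω → EuclideanSpace ℝ (Fin D)) (a b c : ℕ) : MeasurableSpace Ω :=
  (⨆ i ∈ Finset.Icc 1 a, MeasurableSpace.comap (A i) inferInstance) ⊔
  (⨆ i ∈ Finset.Icc 1 b, MeasurableSpace.comap (y i) inferInstance) ⊔
  (⨆ i ∈ Finset.Icc 0 c, MeasurableSpace.comap (p i) inferInstance)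

/-- `ℱ^k`, the history up to and including the `k`-th embedding. -/
def history (A : ℕ → Ω → Matrix (Fin D) (Fin d) ℝ) (y : ℕ → Ω → EuclideanSpace ℝ (Fin d))
    (p : ℕ → Ω → EuclideanSpace ℝ (Fin D)) (k : ℕ) : MeasurableSpace Ω :=
  sigmaGen A y p k k k

/-- `ℱ^(k-1/2)` for `k ≥ 1`: the history just after `A^k` has been drawn. -/
def halfHistory (A : ℕ → Ω → Matrix (Fin D) (Fin d) ℝ) (y : ℕ → Ω → EuclideanSpace ℝ (Fin d))
    (p : ℕ → Ω → EuclideanSpace ℝ (Fin D)) (k : ℕ) : MeasurableSpace Ω :=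
  sigmaGen A y p k (k - 1) (k - 1)

/-- The processes `A`, `y`, `p` form a run of X-REGO: in iteration `k ≥ 1` a Gaussian matrix `A^k`
is drawn independently of the past, then a feasible point `y^k` of the reduced problem at
`p^(k-1)` is computed (by an arbitrary, possibly randomized solver), and then
`p^k ∈ 𝒳` is chosen (arbitrarily, possibly at random). -/
structure IsRun (P : Measure Ω) (A : ℕ → Ω → Matrix (Fin D) (Fin d) ℝ)
    (y : ℕ → Ω → EuclideanSpace ℝ (Fin d)) (p : ℕ → Ω → EuclideanSpace ℝ (Fin D)) : Prop where
  measurable_A : ∀ k, 1 ≤ k → Measurable (A k)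
  measurable_y : ∀ k, 1 ≤ k → Measurable (y k)
  measurable_p : ∀ k, Measurable (p k)
  p_mem : ∀ k, ∀ᵐ ω ∂P, p k ω ∈ box D
  gaussian : ∀ k, 1 ≤ k → P.map (A k) = gaussianMatrix D d
  indep : ∀ k, 1 ≤ k → Indep (MeasurableSpace.comap (A k) inferInstance) (history A y p (k - 1)) P
  y_feasible : ∀ k, 1 ≤ k → ∀ᵐ ω ∂P, y k ω ∈ feasible (A k ω) (p (k - 1) ω)

/-- The event `S^k = 1`: the `k`-th reduced problem is solved to accuracy `lam`, i.e.
`f (A^k y^k + p^(k-1)) ≤ f_min^k + lam`. -/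
def solved (f : EuclideanSpace ℝ (Fin D) → ℝ) (lam : ℝ)
    (A : ℕ → Ω → Matrix (Fin D) (Fin d) ℝ) (y : ℕ → Ω → EuclideanSpace ℝ (Fin d))
    (p : ℕ → Ω → EuclideanSpace ℝ (Fin D)) (k : ℕ) : Set Ω :=
  {ω | f (iterate A y p k ω) ≤ fMin f (A k ω) (p (k - 1) ω) + lam}

/-- For every `k ≥ 1`, `𝔼[S^k | ℱ^(k-1/2)] ≥ ρ` almost surely. -/
def SolvedWithProb (P : Measure Ω) (f : EuclideanSpace ℝ (Fin D) → ℝ) (lam ρ : ℝ)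
    (A : ℕ → Ω → Matrix (Fin D) (Fin d) ℝ) (y : ℕ → Ω → EuclideanSpace ℝ (Fin d))
    (p : ℕ → Ω → EuclideanSpace ℝ (Fin D)) : Prop :=
  ∀ k, 1 ≤ k → ∀ᵐ ω ∂P,
    ρ ≤ (P[(solved f lam A y p k).indicator (fun _ => (1 : ℝ)) | halfHistory A y p k]) ω

/-- `xopt k` is a best point among `x^1, …, x^k`, for every `k ≥ 1` (ties broken arbitrarily). -/
def IsBestIterate (f : EuclideanSpace ℝ (Fin D) → ℝ)
    (A : ℕ → Ω → Matrix (Fin D) (Fin d) ℝ) (y : ℕ → Ω → EuclideanSpace ℝ (Fin d))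
    (p : ℕ → Ω → EuclideanSpace ℝ (Fin D)) (xopt : ℕ → Ω → EuclideanSpace ℝ (Fin D)) : Prop :=
  ∀ k, 1 ≤ k → ∀ ω, ∃ i ∈ Finset.Icc 1 k, xopt k ω = iterate A y p i ω ∧
    ∀ j ∈ Finset.Icc 1 k, f (iterate A y p i ω) ≤ f (iterate A y p j ω)

end XRegoRun

end XRego

end

open XRego

/-! Since `ε - lam > 0`, the `(ε - lam)`-minimizers contain a ball. A Gaussian column has full
support, so for `d ≥ 1` one fixed vector `y` already reaches this ball from any `p` with positive
probability, and compactness of the box makes the bound uniform (`exists_isSuccessBound_of_pos`).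
For `d = 0` the function is constant.

For a run, let `E` be the event that no point among `x^1, …, x^k` is within `ε` of the optimum. `E`
and `p^k` belong to the history, of which the next matrix is independent, so the next reduced
problem is `(ε - lam)`-successful on at least the share `τ` of `E` (`mul_measureReal_le_of_indep`).
That event is known once the matrix is drawn, so the problem is also solved to accuracy `lam` on at
least the share `ρ` of it (`mul_measureReal_le_of_le_condExp_indicator`). The two errors add up to
`ε`, hence each iteration multiplies the failure probability by at most `1 - τ * ρ`
(`IsRun.measureReal_failed_succ_le`). -/

namespace MeasureTheory

/-- If the conditional probability of `S` given `m` is at least `ρ > 0`, then `S` has at least the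
proportion `ρ` of every `m`-measurable event. -/
theorem mul_measureReal_le_of_le_condExp_indicator {Ω : Type*} {m m₀ : MeasurableSpace Ω}
    {P : Measure Ω} [IsProbabilityMeasure P] (hm : m ≤ m₀) {S H : Set Ω} {ρ : ℝ} (hρ : 0 < ρ)
    (hS : ∀ᵐ ω ∂P, ρ ≤ (P[S.indicator (fun _ => (1 : ℝ)) | m]) ω) (hH : MeasurableSet[m] H) :
    ρ * P.real H ≤ P.real (H ∩ S) := by
  -- `S` is not assumed measurable. The conditional expectation of a non-integrable function is `0`
  -- by convention, which `ρ > 0` rules out; integrability then makes `S` null-measurable.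
  have hint : Integrable (S.indicator (fun _ => (1 : ℝ))) P := by
    by_contra h
    rw [condExp_of_not_integrable h] at hS
    obtain ⟨ω, hω⟩ := hS.exists
    simp only [Pi.zero_apply] at hω
    linarith
  have hnull : NullMeasurableSet S P :=
    (aemeasurable_indicator_const_iff (1 : ℝ)).1 hint.aestronglyMeasurable.aemeasurable
  have h1 : ∫ _ in H, ρ ∂P ≤ ∫ ω in H, (P[S.indicator (fun _ => (1 : ℝ)) | m]) ω ∂P :=
    integral_mono_ae (integrable_const ρ) integrable_condExp.integrableOn (ae_restrict_of_ae hS)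
  rw [setIntegral_condExp hm hint hH,
    integral_indicator₀ (hnull.mono_ac Measure.restrict_le_self.absolutelyContinuous),
    setIntegral_const, integral_const, smul_eq_mul, smul_eq_mul, mul_one,
    measureReal_restrict_apply_univ,
    measureReal_restrict_apply₀ (hnull.mono_ac Measure.restrict_le_self.absolutelyContinuous),
    Set.inter_comm, mul_comm] at h1
  exact h1

end MeasureTheory

namespace ProbabilityTheory

/-- If `X` is independent of `m`, if `Y` and `E` are `m`-measurable, and if the section of `W` at
almost every value of `Y` has probability at least `τ` under the law of `X`, then `(X, Y) ∈ W`
occurs on at least the proportion `τ` of `E`. -/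
theorem mul_measureReal_le_of_indep {Ω α β : Type*} {m m₀ : MeasurableSpace Ω}
    [MeasurableSpace α] [MeasurableSpace β] {P : Measure Ω} [IsProbabilityMeasure P]
    (hm : m ≤ m₀) {X : Ω → α} {Y : Ω → β} {E : Set Ω} {W : Set (α × β)} {τ : ℝ}
    (hX : Measurable X) (hind : Indep (MeasurableSpace.comap X inferInstance) m P)
    (hY : Measurable[m] Y) (hE : MeasurableSet[m] E) (hW : MeasurableSet W)
    (hτ : ∀ᵐ ω ∂P, τ ≤ (P.map X).real {a | (a, Y ω) ∈ W}) :
    τ * P.real E ≤ P.real (E ∩ {ω | (X ω, Y ω) ∈ W}) := by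
  -- Pairing `Y` with the truth value of `E` gives one `m`-measurable variable, so that independence
  -- yields a product law and Tonelli applies.
  have hEm : Measurable[m] (fun ω => ω ∈ E) := (@measurableSet_setOfPred _ m _).1 hE
  have hZm : Measurable[m] (fun ω => (Y ω, ω ∈ E)) := hY.prodMk hEm
  have hZ : Measurable (fun ω => (Y ω, ω ∈ E)) := hZm.mono hm le_rfl
  have hXZ : IndepFun X (fun ω => (Y ω, ω ∈ E)) P :=
    (IndepFun_iff_Indep _ _ _).2 (indep_of_indep_of_le_right hind hZm.comap_le)
  have : IsProbabilityMeasure (P.map X) := Measure.isProbabilityMeasure_map hX.aemeasurable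
  set W' : Set (α × β × Prop) := {q | q.2.2 ∧ (q.1, q.2.1) ∈ W} with hW'
  have hW'm : MeasurableSet W' := by
    refine MeasurableSet.inter (measurableSet_setOfPred.2 (measurable_snd.comp measurable_snd)) ?_
    exact (measurable_fst.prodMk (measurable_fst.comp measurable_snd)) hW
  have hpre : E ∩ {ω | (X ω, Y ω) ∈ W} = (fun ω => (X ω, (Y ω, ω ∈ E))) ⁻¹' W' := by
    ext ω; simp [hW']
  have key : ENNReal.ofReal τ * P E ≤ P (E ∩ {ω | (X ω, Y ω) ∈ W}) := by
    rw [hpre, ← Measure.map_apply (hX.prodMk hZ) hW'm,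
      (indepFun_iff_map_prod_eq_prod_map_map hX.aemeasurable hZ.aemeasurable).1 hXZ,
      Measure.prod_apply_symm hW'm, lintegral_map (measurable_measure_prodMk_right hW'm) hZ,
      ← setLIntegral_const]
    refine (setLIntegral_mono_ae' (hm _ hE) (g := fun ω => (P.map X)
      ((fun a => (a, (Y ω, ω ∈ E))) ⁻¹' W')) ?_).trans (setLIntegral_le_lintegral _ _)
    filter_upwards [hτ] with ω hω hωE
    have : ((fun a => (a, (Y ω, ω ∈ E))) ⁻¹' W') = {a | (a, Y ω) ∈ W} := by
      ext a; simp [hW', hωE]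
    rw [this]
    exact ENNReal.ofReal_le_of_le_toReal hω
  by_cases h0 : 0 ≤ τ
  · have := ENNReal.toReal_mono (measure_ne_top _ _) key
    rwa [ENNReal.toReal_mul, ENNReal.toReal_ofReal h0] at this
  · exact (mul_nonpos_of_nonpos_of_nonneg (not_le.1 h0).le measureReal_nonneg).trans
      measureReal_nonneg

end ProbabilityTheory

/-! ### Gaussian matrices and measurability of success -/

namespace XRego

variable {D d : ℕ}

instance (m n : ℕ) : SecondCountableTopology (Matrix (Fin m) (Fin n) ℝ) :=
  inferInstanceAs (SecondCountableTopology (Fin m → Fin n → ℝ))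

instance (m n : ℕ) : BorelSpace (Matrix (Fin m) (Fin n) ℝ) :=
  inferInstanceAs (BorelSpace (Fin m → Fin n → ℝ))

instance : IsProbabilityMeasure (gaussianMatrix D d) :=
  inferInstanceAs (IsProbabilityMeasure
    (Measure.pi (fun _ : Fin D => Measure.pi (fun _ : Fin d => gaussianReal 0 1))))

instance : (gaussianMatrix D d).IsOpenPosMeasure := by
  have : (gaussianReal 0 1).IsOpenPosMeasure :=
    (gaussianReal_absolutelyContinuous' 0 one_ne_zero).isOpenPosMeasure
  have : (Measure.pi fun _ : Fin d => gaussianReal 0 1).IsOpenPosMeasure :=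
    Measure.pi.isOpenPosMeasure _
  exact Measure.pi.isOpenPosMeasure fun _ : Fin D => Measure.pi fun _ : Fin d => gaussianReal 0 1

theorem continuous_act {m n : ℕ} :
    Continuous fun q : Matrix (Fin m) (Fin n) ℝ × EuclideanSpace ℝ (Fin n) => act q.1 q.2 := by
  unfold act
  fun_prop

theorem isCompact_box (D : ℕ) : IsCompact (box D) := by
  have h : box D = WithLp.toLp 2 '' (Set.univ.pi fun _ : Fin D => Set.Icc (-1 : ℝ) 1) := by
    ext x
    constructor
    · exact fun hx => ⟨x.ofLp, fun i _ => hx i, rfl⟩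
    · rintro ⟨z, hz, rfl⟩ i
      exact hz i trivial
  rw [h]
  exact (isCompact_univ_pi fun _ => isCompact_Icc).image (PiLp.continuous_toLp 2 _)

theorem fStar_le {f : EuclideanSpace ℝ (Fin D) → ℝ} (hf : Continuous f)
    {x : EuclideanSpace ℝ (Fin D)} (hx : x ∈ box D) : fStar f ≤ f x :=
  csInf_le ((isCompact_box D).bddBelow_image hf.continuousOn) ⟨x, hx, rfl⟩

theorem fMin_le {f : EuclideanSpace ℝ (Fin D) → ℝ} (hf : Continuous f)
    {A : Matrix (Fin D) (Fin d) ℝ} {p : EuclideanSpace ℝ (Fin D)}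
    {y : EuclideanSpace ℝ (Fin d)} (hy : y ∈ feasible A p) : fMin f A p ≤ f (act A y + p) := by
  refine csInf_le ⟨fStar f, ?_⟩ ⟨y, hy, rfl⟩
  rintro _ ⟨z, hz, rfl⟩
  exact fStar_le hf hz

/-- The set of successful pairs `(A, p)` is a countable union of closed sets. -/
theorem measurableSet_epsSuccessful {f : EuclideanSpace ℝ (Fin D) → ℝ} (hf : Continuous f)
    (δ : ℝ) : MeasurableSet {q : Matrix (Fin D) (Fin d) ℝ × EuclideanSpace ℝ (Fin D) |
      EpsSuccessful f δ q.1 q.2} := by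
  -- Bounding `y` by `n` makes the fibre compact, so the projection that eliminates `y` maps closed
  -- sets to closed sets.
  let C (n : ℕ) : Set ((Matrix (Fin D) (Fin d) ℝ × EuclideanSpace ℝ (Fin D)) ×
      Metric.closedBall (0 : EuclideanSpace ℝ (Fin d)) n) :=
    {q | act q.1.1 q.2 + q.1.2 ∈ box D ∧ f (act q.1.1 q.2 + q.1.2) ≤ fStar f + δ}
  have hc (n : ℕ) : Continuous fun q : (Matrix (Fin D) (Fin d) ℝ × EuclideanSpace ℝ (Fin D)) ×
      Metric.closedBall (0 : EuclideanSpace ℝ (Fin d)) n =>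
        act q.1.1 q.2 + q.1.2 :=
    (continuous_act.comp (f := fun q : (Matrix (Fin D) (Fin d) ℝ × EuclideanSpace ℝ (Fin D)) ×
      Metric.closedBall (0 : EuclideanSpace ℝ (Fin d)) n => (q.1.1, (q.2 : EuclideanSpace ℝ _)))
      (by fun_prop)).add (by fun_prop)
  have hC (n : ℕ) : IsClosed (C n) :=
    ((isCompact_box D).isClosed.preimage (hc n)).inter
      (isClosed_le (hf.comp (hc n)) continuous_const)
  have hU : {q : Matrix (Fin D) (Fin d) ℝ × EuclideanSpace ℝ (Fin D) |
      EpsSuccessful f δ q.1 q.2} = ⋃ n, Prod.fst '' C n := by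
    ext q
    simp only [Set.mem_ofPred_eq, Set.mem_iUnion]
    constructor
    · rintro ⟨y, hy, hfy⟩
      obtain ⟨n, hn⟩ := exists_nat_ge ‖y‖
      exact ⟨n, (q, ⟨y, by simpa using hn⟩), ⟨hy, hfy⟩, rfl⟩
    · rintro ⟨n, ⟨q', y⟩, ⟨hy, hfy⟩, rfl⟩
      exact ⟨y, hy, hfy⟩
  rw [hU]
  exact MeasurableSet.iUnion fun n => (isClosedMap_fst_of_compactSpace _ (hC n)).measurableSet

/-! ### A uniform lower bound on the success probability -/

theorem abs_apply_le_norm (x : EuclideanSpace ℝ (Fin D)) (i : Fin D) : |x i| ≤ ‖x‖ :=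
  PiLp.norm_apply_le x i

/-- The `δ`-minimizers contain a ball: move a minimizer slightly towards the centre of the box. -/
theorem exists_ball_subset_epsMinimizers {f : EuclideanSpace ℝ (Fin D) → ℝ} (hf : Continuous f)
    {δ : ℝ} (hδ : 0 < δ) : ∃ z, ∃ r > 0, Metric.ball z r ⊆ epsMinimizers f δ := by
  obtain ⟨x, hx, hmin⟩ := (isCompact_box D).exists_sInf_image_eq
    ⟨0, fun i => by norm_num⟩ hf.continuousOn
  have hfx : f x < fStar f + δ := by
    have : fStar f = f x := hmin
    linarith
  have hcont : Continuous fun t : ℝ => f (t • x) := by fun_prop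
  have hev : ∀ᶠ t in 𝓝[<] (1 : ℝ), f (t • x) < fStar f + δ :=
    nhdsWithin_le_nhds <| hcont.continuousAt.eventually_lt continuousAt_const (by simpa using hfx)
  obtain ⟨t, ht, ht1, ht0⟩ := (hev.and ((eventually_mem_nhdsWithin).and
    (nhdsWithin_le_nhds (eventually_gt_nhds zero_lt_one)))).exists
  have ht1 : t < 1 := ht1
  obtain ⟨r, hr, hball⟩ := Metric.isOpen_iff.1 (isOpen_lt hf continuous_const) (t • x) ht
  -- The coordinates of `t • x` are at most `t` in absolute value, so radius `1 - t` stays in the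
  -- box; radius `r` keeps `f` small.
  refine ⟨t • x, min r (1 - t), lt_min hr (by linarith), fun w hw => ⟨fun i => ?_, ?_⟩⟩
  · have h1 : |w i - t * x i| < 1 - t := by
      have := abs_apply_le_norm (w - t • x) i
      rw [← dist_eq_norm] at this
      exact this.trans_lt ((Metric.mem_ball.1 hw).trans_le (min_le_right _ _))
    obtain ⟨h2, h3⟩ := abs_lt.1 h1
    obtain ⟨h4, h5⟩ := hx i
    constructor <;> nlinarith
  · exact (hball (Metric.ball_subset_ball (min_le_left _ _) hw)).le

/-- If `d ≥ 1`, the first column of a Gaussian matrix hits a ball of `δ`-minimizers, translated by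
`-p`, with a probability that is bounded below over the compact box. As `δ > 0`, this needs neither the
effective dimension nor a non-degenerate component. -/
theorem exists_isSuccessBound_of_pos {f : EuclideanSpace ℝ (Fin D) → ℝ} (hf : Continuous f)
    (hd : 0 < d) {δ : ℝ} (hδ : 0 < δ) :
    ∃ τ : ℝ, 0 < τ ∧ IsSuccessBound f d δ τ := by
  obtain ⟨z, r, hr, hball⟩ := exists_ball_subset_epsMinimizers hf hδ
  set e : EuclideanSpace ℝ (Fin d) := EuclideanSpace.single ⟨0, hd⟩ 1 with he
  let O (q : EuclideanSpace ℝ (Fin D)) : Set (Matrix (Fin D) (Fin d) ℝ) :=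
    {A | act A e + q ∈ Metric.ball z (r / 2)}
  have hcont (q : EuclideanSpace ℝ (Fin D)) :
      Continuous fun A : Matrix (Fin D) (Fin d) ℝ => act A e + q :=
    (continuous_act.comp (by fun_prop : Continuous fun A : Matrix (Fin D) (Fin d) ℝ =>
      (A, e))).add continuous_const
  have hpos (q : EuclideanSpace ℝ (Fin D)) : 0 < (gaussianMatrix D d).real (O q) := by
    refine ENNReal.toReal_pos ?_ (measure_ne_top _ _)
    refine (IsOpen.measure_pos _ (Metric.isOpen_ball.preimage (hcont q)) ?_).ne'
    -- With every column equal to `z - q`, the image of `e` is exactly `z - q`.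
    refine ⟨Matrix.of fun i _ => (z - q) i, ?_⟩
    have : act (Matrix.of fun i _ => (z - q) i) e + q = z := by
      ext i
      simp [act, he]
    change act _ e + q ∈ Metric.ball z (r / 2)
    rw [this]
    exact Metric.mem_ball_self (half_pos hr)
  -- Half radii leave room for the triangle inequality: hitting the half ball from a centre `q`
  -- means hitting the full ball from any `p` within `r / 2` of `q`. The bound is the least of
  -- finitely many positive probabilities.
  obtain ⟨t, -, ht⟩ := (isCompact_box D).elim_nhds_subcover
    (fun q => Metric.ball q (r / 2)) fun q _ => Metric.ball_mem_nhds q (by linarith)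
  have h0 : (0 : EuclideanSpace ℝ (Fin D)) ∈ box D := fun i => by norm_num
  have hne : t.Nonempty := by
    obtain ⟨q, hq, -⟩ := Set.mem_iUnion₂.1 (ht h0)
    exact ⟨q, hq⟩
  obtain ⟨q₀, -, hq₀⟩ := t.exists_min_image (fun q => (gaussianMatrix D d).real (O q)) hne
  refine ⟨_, hpos q₀, fun p hp => ?_⟩
  obtain ⟨q, hq, hpq⟩ := Set.mem_iUnion₂.1 (ht hp)
  refine (hq₀ q hq).trans (measureReal_mono fun A hA => ⟨e, ?_⟩)
  have hmem : act A e + p ∈ Metric.ball z r := by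
    have h1 : dist (act A e + p) (act A e + q) < r / 2 := by simpa using hpq
    have h2 : dist (act A e + q) z < r / 2 := hA
    exact Metric.mem_ball.2 ((dist_triangle _ (act A e + q) _).trans_lt (by linarith))
  exact hball hmem

/-- Every feasible point is optimal, and `y = 0` is feasible because `p` lies in the box. This
settles `d = 0`, where `de ≤ d` leaves only constant functions. -/
theorem isSuccessBound_one_of_const {f : EuclideanSpace ℝ (Fin D) → ℝ}
    (hconst : ∀ x, f x = f 0) {δ : ℝ} (hδ : 0 ≤ δ) : IsSuccessBound f d δ 1 := by
  intro p hp
  have huniv : {A : Matrix (Fin D) (Fin d) ℝ | EpsSuccessful f δ A p} = Set.univ := by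
    refine Set.eq_univ_of_forall fun A => ⟨0, ?_, ?_⟩
    · simpa [feasible, act] using hp
    · have : f 0 ≤ fStar f := le_csInf ⟨_, p, hp, rfl⟩ (by rintro _ ⟨x, -, rfl⟩; exact (hconst x).ge)
      rw [hconst]
      linarith
  rw [huniv, probReal_univ]

theorem IsSuccessBound.le_one {f : EuclideanSpace ℝ (Fin D) → ℝ} {δ τ : ℝ}
    (h : IsSuccessBound f d δ τ) : τ ≤ 1 :=
  (h 0 fun i => by norm_num).trans measureReal_le_one

/-- A function that varies only along a zero-dimensional subspace is constant. -/
theorem VariesOnlyAlong.eq_zero_apply {f : EuclideanSpace ℝ (Fin D) → ℝ}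
    {T : Submodule ℝ (EuclideanSpace ℝ (Fin D))} (h : VariesOnlyAlong f T)
    (hT : Module.finrank ℝ T = 0) (x : EuclideanSpace ℝ (Fin D)) : f x = f 0 := by
  have hbot : T = ⊥ := Submodule.finrank_eq_zero.1 hT
  simpa using h 0 T.zero_mem x (by simp [hbot])

theorem exists_isSuccessBound {de : ℕ} {f : EuclideanSpace ℝ (Fin D) → ℝ}
    {T : Submodule ℝ (EuclideanSpace ℝ (Fin D))} {U : Matrix (Fin D) (Fin de) ℝ}
    {V : Matrix (Fin D) (Fin (D - de)) ℝ} (hdim : LowEffectiveDim f d de T U V) {δ : ℝ}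
    (hδ : 0 < δ) : ∃ τ : ℝ, 0 < τ ∧ τ ≤ 1 ∧ IsSuccessBound f d δ τ := by
  rcases Nat.eq_zero_or_pos d with hd | hd
  · have hT : Module.finrank ℝ T = 0 := by
      have h1 := hdim.le_embedding
      have h2 := hdim.finrank_eq
      omega
    exact ⟨1, one_pos, le_rfl,
      isSuccessBound_one_of_const (hdim.varies.eq_zero_apply hT) hδ.le⟩
  · obtain ⟨τ, hτ, h⟩ := exists_isSuccessBound_of_pos hdim.continuous hd hδ
    exact ⟨τ, hτ, h.le_one, h⟩

/-! ### Geometric decay of the failure probability along a run -/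

section Run

variable {Ω : Type*} {A : ℕ → Ω → Matrix (Fin D) (Fin d) ℝ} {y : ℕ → Ω → EuclideanSpace ℝ (Fin d)}
  {p : ℕ → Ω → EuclideanSpace ℝ (Fin D)}

theorem sigmaGen_mono {a b c a' b' c' : ℕ} (ha : a ≤ a') (hb : b ≤ b') (hc : c ≤ c') :
    sigmaGen A y p a b c ≤ sigmaGen A y p a' b' c' :=
  sup_le_sup (sup_le_sup
    (biSup_mono fun _ hi => Finset.Icc_subset_Icc_right ha hi)
    (biSup_mono fun _ hi => Finset.Icc_subset_Icc_right hb hi))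
    (biSup_mono fun _ hi => Finset.Icc_subset_Icc_right hc hi)

theorem measurable_sigmaGen_A {a b c i : ℕ} (hi : i ∈ Finset.Icc 1 a) :
    Measurable[sigmaGen A y p a b c] (A i) := by
  refine measurable_iff_comap_le.2 (le_trans ?_ (le_sup_left.trans le_sup_left))
  exact le_biSup (fun i => MeasurableSpace.comap (A i) inferInstance) hi

theorem measurable_sigmaGen_y {a b c i : ℕ} (hi : i ∈ Finset.Icc 1 b) :
    Measurable[sigmaGen A y p a b c] (y i) := by
  refine measurable_iff_comap_le.2 (le_trans ?_ (le_sup_right.trans le_sup_left))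
  exact le_biSup (fun i => MeasurableSpace.comap (y i) inferInstance) hi

theorem measurable_sigmaGen_p {a b c i : ℕ} (hi : i ≤ c) :
    Measurable[sigmaGen A y p a b c] (p i) := by
  refine measurable_iff_comap_le.2 (le_trans ?_ le_sup_right)
  exact le_biSup (fun i => MeasurableSpace.comap (p i) inferInstance)
    (Finset.mem_Icc.2 ⟨Nat.zero_le _, hi⟩)

theorem measurable_iterate {k j : ℕ} (hj : j ∈ Finset.Icc 1 k) :
    Measurable[history A y p k] (iterate A y p j) := by
  have hjk := Finset.mem_Icc.1 hj
  have hp : Measurable[history A y p k] (p (j - 1)) := measurable_sigmaGen_p (by omega)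
  have hA : Measurable[history A y p k] (A j) := measurable_sigmaGen_A hj
  have hy : Measurable[history A y p k] (y j) := measurable_sigmaGen_y hj
  exact (continuous_act.measurable.comp (hA.prodMk hy)).add hp

/-- The event that none of `x^1, …, x^k` has value at most `c`. -/
def failed (f : EuclideanSpace ℝ (Fin D) → ℝ) (c : ℝ)
    (A : ℕ → Ω → Matrix (Fin D) (Fin d) ℝ) (y : ℕ → Ω → EuclideanSpace ℝ (Fin d))
    (p : ℕ → Ω → EuclideanSpace ℝ (Fin D)) (k : ℕ) : Set Ω :=
  {ω | ∀ j ∈ Finset.Icc 1 k, c < f (iterate A y p j ω)}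

theorem measurableSet_failed {f : EuclideanSpace ℝ (Fin D) → ℝ} (hf : Continuous f) (c : ℝ)
    (k : ℕ) : MeasurableSet[history A y p k] (failed f c A y p k) := by
  have h : failed f c A y p k =
      ⋂ j ∈ Finset.Icc 1 k, (fun ω => f (iterate A y p j ω)) ⁻¹' Set.Ioi c := by
    ext ω; simp [failed]
  rw [h]
  exact Finset.measurableSet_biInter (m := history A y p k) _ fun j hj =>
    (hf.measurable.comp (measurable_iterate hj)) measurableSet_Ioi

/-- No measurability of `xopt` is assumed; this identity shows that its success event is
nevertheless measurable. -/
theorem IsBestIterate.setOf_le_eq {f : EuclideanSpace ℝ (Fin D) → ℝ}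
    {xopt : ℕ → Ω → EuclideanSpace ℝ (Fin D)} (h : IsBestIterate f A y p xopt) (c : ℝ) {k : ℕ}
    (hk : 1 ≤ k) : {ω | f (xopt k ω) ≤ c} = (failed f c A y p k)ᶜ := by
  ext ω
  obtain ⟨i, hi, hx, hbest⟩ := h k hk ω
  simp only [Set.mem_ofPred_eq, Set.mem_compl_iff, failed, not_forall, not_lt]
  rw [hx]
  exact ⟨fun hle => ⟨i, hi, hle⟩, fun ⟨j, hj, hle⟩ => (hbest j hj).trans hle⟩

variable [mΩ : MeasurableSpace Ω] {P : Measure Ω}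

theorem IsRun.sigmaGen_le (h : IsRun P A y p) (a b c : ℕ) : sigmaGen A y p a b c ≤ mΩ :=
  sup_le (sup_le
    (iSup₂_le fun i hi => (h.measurable_A i (Finset.mem_Icc.1 hi).1).comap_le)
    (iSup₂_le fun i hi => (h.measurable_y i (Finset.mem_Icc.1 hi).1).comap_le))
    (iSup₂_le fun i _ => (h.measurable_p i).comap_le)

theorem IsRun.measureReal_failed_succ_le [IsProbabilityMeasure P]
    {f : EuclideanSpace ℝ (Fin D) → ℝ} (hf : Continuous f) {ε lam τ ρ : ℝ}
    (hrun : IsRun P A y p) (hτ : IsSuccessBound f d (ε - lam) τ) (hρ : 0 < ρ)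
    (hsolved : SolvedWithProb P f lam ρ A y p) (k : ℕ) :
    P.real (failed f (fStar f + ε) A y p (k + 1)) ≤
      (1 - τ * ρ) * P.real (failed f (fStar f + ε) A y p k) := by
  set c := fStar f + ε with hc
  set E := failed f c A y p k
  set R : Set Ω := {ω | EpsSuccessful f (ε - lam) (A (k + 1) ω) (p k ω)} with hR
  set S := solved f lam A y p (k + 1)
  have hk : 1 ≤ k + 1 := by omega
  have hW := measurableSet_epsSuccessful (d := d) hf (ε - lam)
  have hE : MeasurableSet[history A y p k] E := measurableSet_failed hf c k
  have h1 : τ * P.real E ≤ P.real (E ∩ R) := by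
    refine mul_measureReal_le_of_indep (hrun.sigmaGen_le k k k) (hrun.measurable_A _ hk)
      (hrun.indep (k + 1) hk) (measurable_sigmaGen_p le_rfl) hE hW ?_
    filter_upwards [hrun.p_mem k] with ω hω
    rw [hrun.gaussian _ hk]
    exact hτ _ hω
  -- The matrix `A (k + 1)` is part of the half history, so `R` may be conditioned on there, though
  -- not in `history A y p k`.
  have hER : MeasurableSet[halfHistory A y p (k + 1)] (E ∩ R) := by
    have hE' : MeasurableSet[halfHistory A y p (k + 1)] E :=
      sigmaGen_mono (by omega) (by omega) (by omega) _ hE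
    have hA : Measurable[halfHistory A y p (k + 1)] (A (k + 1)) :=
      measurable_sigmaGen_A (Finset.mem_Icc.2 ⟨hk, le_rfl⟩)
    have hp : Measurable[halfHistory A y p (k + 1)] (p k) := measurable_sigmaGen_p (by omega)
    exact hE'.inter ((hA.prodMk hp) hW)
  have h2 : ρ * P.real (E ∩ R) ≤ P.real (E ∩ R ∩ S) :=
    mul_measureReal_le_of_le_condExp_indicator (hrun.sigmaGen_le _ _ _) hρ (hsolved _ hk) hER
  have hsub : failed f c A y p (k + 1) ⊆ E := fun ω hω j hj =>
    hω j (Finset.Icc_subset_Icc_right (by omega) hj)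
  -- On `R ∩ S`, `f (x^(k+1)) ≤ f_min + lam ≤ f* + (ε - lam) + lam`.
  have hdisj : Disjoint (E ∩ R ∩ S) (failed f c A y p (k + 1)) := by
    refine Set.disjoint_left.2 fun ω hω hfail => ?_
    obtain ⟨⟨-, z, hz, hfz⟩, hS⟩ := hω
    have hS : f (iterate A y p (k + 1) ω) ≤ fMin f (A (k + 1) ω) (p k ω) + lam := hS
    have h3 := fMin_le hf hz
    have h4 := hfail (k + 1) (Finset.mem_Icc.2 ⟨hk, le_rfl⟩)
    linarith
  have h3 : P.real (E ∩ R ∩ S) + P.real (failed f c A y p (k + 1)) ≤ P.real E := by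
    -- Additivity needs measurability of only one of the sets, here the failure event; `S` may be
    -- non-measurable.
    rw [← measureReal_union hdisj
      (hrun.sigmaGen_le _ _ _ _ (measurableSet_failed hf c (k + 1)))]
    exact measureReal_mono (Set.union_subset (fun ω hω => hω.1.1) hsub)
  nlinarith [mul_le_mul_of_nonneg_left h1 hρ.le]

theorem IsRun.measureReal_failed_le [IsProbabilityMeasure P]
    {f : EuclideanSpace ℝ (Fin D) → ℝ} (hf : Continuous f) {ε lam τ ρ : ℝ}
    (hrun : IsRun P A y p) (hτ : IsSuccessBound f d (ε - lam) τ) (hρ : 0 < ρ) (hτρ : τ * ρ ≤ 1)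
    (hsolved : SolvedWithProb P f lam ρ A y p) (k : ℕ) :
    P.real (failed f (fStar f + ε) A y p k) ≤ (1 - τ * ρ) ^ k := by
  induction k with
  | zero => simp
  | succ k ih =>
    rw [pow_succ']
    exact (hrun.measureReal_failed_succ_le hf hτ hρ hsolved k).trans
      (mul_le_mul_of_nonneg_left ih (by linarith))

/-- The iterates are almost surely feasible, so the two events differ by a null set. -/
theorem IsRun.measureReal_mem_epsMinimizers {f : EuclideanSpace ℝ (Fin D) → ℝ}
    {xopt : ℕ → Ω → EuclideanSpace ℝ (Fin D)} (hrun : IsRun P A y p)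
    (h : IsBestIterate f A y p xopt) (ε : ℝ) {k : ℕ} (hk : 1 ≤ k) :
    P.real {ω | xopt k ω ∈ epsMinimizers f ε} = P.real {ω | f (xopt k ω) ≤ fStar f + ε} := by
  have hfeas : ∀ᵐ ω ∂P, ∀ i, 1 ≤ i → iterate A y p i ω ∈ box D :=
    ae_all_iff.2 fun i => by
      by_cases hi : 1 ≤ i
      · filter_upwards [hrun.y_feasible i hi] with ω hω _ using hω
      · exact .of_forall fun ω h => absurd h hi
  refine measureReal_congr ?_
  filter_upwards [hfeas] with ω hω
  obtain ⟨i, hi, hx, -⟩ := h k hk ω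
  refine propext ⟨fun h => h.2, fun h => ⟨?_, h⟩⟩
  rw [hx]
  exact hω i (Finset.mem_Icc.1 hi).1

end Run

/-- The number of iterations that makes the geometric bound reach the confidence level `ξ`. -/
theorem le_one_sub_pow_of_ceil_le {a ξ : ℝ} (ha : 0 < a) (ha1 : a ≤ 1) (hξ : 0 < ξ) (hξ1 : ξ < 1)
    {k : ℕ} (hk : ⌈|Real.log (1 - ξ)| / a⌉₊ ≤ k) : 1 ≤ k ∧ ξ ≤ 1 - (1 - a) ^ k := by
  have hlog : Real.log (1 - ξ) < 0 := Real.log_neg (by linarith) (by linarith)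
  have hle : |Real.log (1 - ξ)| / a ≤ k := Nat.ceil_le.1 hk
  refine ⟨?_, ?_⟩
  · have : (0 : ℝ) < k := (div_pos (abs_pos.2 hlog.ne) ha).trans_le hle
    exact_mod_cast this
  · rw [div_le_iff₀ ha, abs_of_neg hlog] at hle
    have h1 : (1 - a) ^ k ≤ Real.exp (-a) ^ k :=
      pow_le_pow_left₀ (by linarith) (Real.one_sub_le_exp_neg a) k
    have h2 : Real.exp (-a) ^ k ≤ 1 - ξ := by
      rw [← Real.exp_nat_mul]
      refine (Real.le_log_iff_exp_le (by linarith)).1 ?_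
      linarith
    linarith

end XRego

theorem mainTheorem6 {D d de : ℕ} (f : EuclideanSpace ℝ (Fin D) → ℝ)
    (T : Submodule ℝ (EuclideanSpace ℝ (Fin D)))
    (U : Matrix (Fin D) (Fin de) ℝ) (V : Matrix (Fin D) (Fin (D - de)) ℝ)
    (hdim : LowEffectiveDim f d de T U V)
    (hnondeg : ExistsNondegenerate f T U V)
    (L : ℝ≥0) (hLip : LipschitzWith L f)
    (ε lam : ℝ) (hlam : 0 < lam) (hlamε : lam < ε) :
    (∃ τ : ℝ, 0 < τ ∧ τ ≤ 1 ∧ IsSuccessBound f d (ε - lam) τ) ∧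
    ∀ τ : ℝ, 0 < τ → IsSuccessBound f d (ε - lam) τ →
      ∀ (Ω : Type*) [MeasurableSpace Ω] (P : Measure Ω) [IsProbabilityMeasure P]
        (A : ℕ → Ω → Matrix (Fin D) (Fin d) ℝ) (y : ℕ → Ω → EuclideanSpace ℝ (Fin d))
        (p xopt : ℕ → Ω → EuclideanSpace ℝ (Fin D)) (ρ : ℝ),
        IsRun P A y p → 0 < ρ → ρ ≤ 1 → SolvedWithProb P f lam ρ A y p →
        IsBestIterate f A y p xopt →
        (∀ k : ℕ, 1 ≤ k →
          P.real {ω | xopt k ω ∈ epsMinimizers f ε} =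
            P.real {ω | f (xopt k ω) ≤ fStar f + ε} ∧
          1 - (1 - τ * ρ) ^ k ≤ P.real {ω | f (xopt k ω) ≤ fStar f + ε}) ∧
        Tendsto (fun k : ℕ => 1 - (1 - τ * ρ) ^ k) atTop (𝓝 1) ∧
        Tendsto (fun k : ℕ => P.real {ω | xopt k ω ∈ epsMinimizers f ε}) atTop (𝓝 1) ∧
        Tendsto (fun k : ℕ => P.real {ω | f (xopt k ω) ≤ fStar f + ε}) atTop (𝓝 1) ∧
        ∀ ξ : ℝ, 0 < ξ → ξ < 1 → ∀ k : ℕ, ⌈|Real.log (1 - ξ)| / (τ * ρ)⌉₊ ≤ k →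
          ξ ≤ P.real {ω | xopt k ω ∈ epsMinimizers f ε} ∧
          ξ ≤ P.real {ω | f (xopt k ω) ≤ fStar f + ε} := by
  have hf := hdim.continuous
  refine ⟨exists_isSuccessBound hdim (sub_pos.2 hlamε), ?_⟩
  intro τ hτ hbound Ω _ P _ A y p xopt ρ hrun hρ hρ1 hsolved hbest
  have ha : 0 < τ * ρ := mul_pos hτ hρ
  have ha1 : τ * ρ ≤ 1 := mul_le_one₀ hbound.le_one hρ.le hρ1
  have heq (k : ℕ) (hk : 1 ≤ k) := hrun.measureReal_mem_epsMinimizers hbest ε hk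
  have hlow (k : ℕ) (hk : 1 ≤ k) :
      1 - (1 - τ * ρ) ^ k ≤ P.real {ω | f (xopt k ω) ≤ fStar f + ε} := by
    rw [hbest.setOf_le_eq _ hk, probReal_compl_eq_one_sub
      (hrun.sigmaGen_le _ _ _ _ (measurableSet_failed hf _ k))]
    linarith [hrun.measureReal_failed_le hf hbound hρ ha1 hsolved k]
  have hpow : Tendsto (fun k : ℕ => 1 - (1 - τ * ρ) ^ k) atTop (𝓝 1) := by
    simpa using (tendsto_pow_atTop_nhds_zero_of_lt_one (r := 1 - τ * ρ)
      (by linarith) (by linarith)).const_sub 1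
  -- The lower bound holds only from `k = 1` on, which suffices for the squeeze.
  have hlim : Tendsto (fun k : ℕ => P.real {ω | f (xopt k ω) ≤ fStar f + ε}) atTop (𝓝 1) :=
    tendsto_of_tendsto_of_tendsto_of_le_of_le' hpow tendsto_const_nhds
      ((eventually_ge_atTop 1).mono hlow) (.of_forall fun _ => measureReal_le_one)
  refine ⟨fun k hk => ⟨heq k hk, hlow k hk⟩, hpow, ?_, hlim, ?_⟩
  · exact hlim.congr' ((eventually_ge_atTop 1).mono fun k hk => (heq k hk).symm)
  · intro ξ hξ hξ1 k hk
    obtain ⟨hk1, hle⟩ := le_one_sub_pow_of_ceil_le ha ha1 hξ hξ1 hk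
    have := hle.trans (hlow k hk1)
    exact ⟨(heq k hk1).symm ▸ this, this⟩
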